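/- **Setting.** A random unit has a source $S\in\{r,o\}$ (trial or observational study, both of positive probability), a treatment $A\in\{-1,1\}$, integrable potential outcomes $Y(\pm1)$ with $Y=Y(A)$, and covariates $U\in\mathbb R^{p_u}$, $Z\in\mathbb R^{p_z}$, $V\in\mathbb R^{p_v}$; the trial records $X^r=(U,Z)$, the observational study $X^o=(Z,V)$, $p_o=p_z+p_v$. Let $\tau^r(X^r)=\mathbb E[Y(1)-Y(-1)\mid X^r,S=r]$, and for a class $\mathcal F$ of functions of $X^r$ let $\Delta_2^2(\mathcal F,\tau^r)=\inf_{f\in\mathcal F}\mathbb E[(f(X^r)-\tau^r(X^r))^2\mid S=r]$. $\mathfrak R_n$ denotes Rademacher complexity $\mathbb E\sup_f|\frac1n\sum_i\sigma_i f(x_i)|$ under the law of the arguments in the relevant source (for vector-valued classes, with one sign per draw and coordinate). All quantities take values in $[0,\infty]$. *Calm* uses encoders $\phi^o:\mathbb R^{p_o}\to\mathbb R^d$, $\phi^r:\mathbb R^{p_u+p_z}\to\mathbb R^d$, outcome classes $\mathcal M^s_a$ and discrepancy classes $\mathcal D_a$ on $\mathbb R^d$ ($s\in\{r,o\}$, $a=\pm1$),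 fitted heads $\hat\mu^o_a\in\mathcal M^o_a$, $\hat\delta_a\in\mathcal D_a$, a class $\mathcal D$ of corrections, and $\mathcal F=\{\sum_a a(\hat\mu^o_a+\hat\delta_a)\circ\phi^r+c : c\in\mathcal D\}$. Put $r_\phi^2=\mathbb E[\|\phi^o(Z,V)-\phi^r(X^r)\|^2\mid S=r]$. *MR-Oscar* uses an imputation class $\mathcal G$ of maps $\mathbb R^{p_z}\to\mathbb R^{p_v}$ with fitted $\hat g\in\mathcal G$, outcome classes $\mathcal M^{o,\mathrm{im}}_a$ of functions of $(z,v)$ that are $L$-Lipschitz in $v$, discrepancy classes $\mathcal D^{\mathrm{im}}_a$ and a correction class on $(u,z,\hat g(z))$, fitted heads in these classes, and the class $\mathcal F^{\mathrm{im}}$ of final CATE estimators that they induce in the same way. Put $r_{\mathrm{im}}^2=\inf_{g\in\mathcal G}\mathbb E[\|V-g(Z)\|^2\mid S=o]$. For $C>0$, $\gamma\in(0,1)$ and sample sizes $n^r,n^o\ge1$ the risk bounds are $$B_{\mathrm{Calm}}=\Delta_2^2(\mathcal F,\tau^r)+C\tfrac{\log(1/\gamma)}{n^r}+C\Big[\epsilon_{\mathrm{suff}}^2+(L_\mu+L_\delta)^2r_\phi^2+\sum_a\mathfrak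 R_{n^o}^2(\mathcal M^o_a)+\sum_a\mathfrak R_{n^r}^2(\mathcal D_a)+\mathfrak R_{n^r}^2(\mathcal F)\Big],$$ $$B_{\mathrm{MR}}=\Delta_2^2(\mathcal F^{\mathrm{im}},\tau^r)+C\tfrac{\log(1/\gamma)}{n^r}+C\Big[L^2r_{\mathrm{im}}^2+\mathfrak R_{n^r}^2(\mathcal F^{\mathrm{im}})+\sum_a\big(\mathfrak R_{n^o}^2(\mathcal M^{o,\mathrm{im}}_a)+\mathfrak R_{n^r}^2(\mathcal D^{\mathrm{im}}_a)\big)+\mathfrak R_{n^o}^2(\mathcal G)\Big].$$ **Assumptions.** Internal validity of the trial: $(Y(1),Y(-1))\perp A\mid X^r$ given $S=r$, and for some $\rho>0$ the trial propensities lie in $[\rho,1-\rho]$ almost surely. There are $\tilde\mu^s_a\in\mathcal M^s_a$ and $\delta_a\in\mathcal D_a$ with $\tilde\mu^r_a=\tilde\mu^o_a+\delta_a$, with $\tilde\mu^o_a$ $L_\mu$-Lipschitz, $\delta_a$ $L_\delta$-Lipschitz, and $\mathbb E[(\mu^s_a(X^s)-\tilde\mu^s_a(\phi^s(X^s)))^2\mid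 S=s]\le\epsilon_{\mathrm{suff}}^2$ for a version $\mu^s_a$ of $\mathbb E[Y\mid X^s,A=a,S=s]$. Moreover $r_\phi^2<\infty$. The calibration classes are called *$\kappa$-comparable* ($\kappa\ge1$) if $\mathfrak R^2_{n^r}(\mathcal D_a)$ and $\mathfrak R^2_{n^r}(\mathcal D^{\mathrm{im}}_a)$ (for each $a$), $\mathfrak R^2_{n^r}(\mathcal F)$ and $\mathfrak R^2_{n^r}(\mathcal F^{\mathrm{im}})$, and $\Delta_2^2(\mathcal F,\tau^r)$ and $\Delta_2^2(\mathcal F^{\mathrm{im}},\tau^r)$ are finite and agree up to the factor $\kappa$. **Claim 1.** Consider the inequality $$(\ast)\qquad \epsilon_{\mathrm{suff}}^2+(L_\mu+L_\delta)^2r_\phi^2+\sum_a\mathfrak R_{n^o}^2(\mathcal M^o_a)<L^2r_{\mathrm{im}}^2+\sum_a\mathfrak R_{n^o}^2(\mathcal M^{o,\mathrm{im}}_a)+\mathfrak R_{n^o}^2(\mathcal G).$$ If the calibration classes are $1$-comparable, then $B_{\mathrm{Calm}}<B_{\mathrm{MR}}$ if and only if $(\ast)$ holds. If they are $\kappa$-comparable,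 then $(\ast)$ implies $B_{\mathrm{Calm}}<\kappa B_{\mathrm{MR}}$, and $\kappa B_{\mathrm{Calm}}<B_{\mathrm{MR}}$ implies $(\ast)$. **Claim 2** ($d\ll p_o$, $r_\phi^2\ll r_{\mathrm{im}}^2$, small sufficiency gap). For every $K\ge0$ there is $\theta>0$ such that for every $\psi:\mathbb N\to[0,\infty)$ with $\psi(q)\to\infty$ and every $d$ there is $N$ such that $(\ast)$ holds in every such problem with embedding dimension $d$ (with any $n^o\ge1$) for which the right-hand side of $(\ast)$ is positive and: (i) the complexities of the outcome classes are governed by the dimension, $\mathfrak R^2_{n^o}(\mathcal M^o_a)\le K\,t\,\psi(d)$ and $t\,\psi(p_o)\le K\,\mathfrak R^2_{n^o}(\mathcal M^{o,\mathrm{im}}_a)$ for some $t\ge0$ and both $a$, and $p_o\ge N$; (ii) $L_\mu+L_\delta\le KL$ and $r_\phi^2\le\theta\,r_{\mathrm{im}}^2$; (iii) $\epsilon_{\mathrm{suff}}^2$ is at most $\theta$ times the right-hand side of $(\ast)$. -/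

import Mathlib

open MeasureTheory ProbabilityTheory Filter
open scoped ENNReal NNReal

universe u

noncomputable section

namespace Mismatch

/-! ### Rademacher complexities -/

/-- Rademacher complexity `E_x E_σ sup_{f ∈ F} |n⁻¹ ∑ i, σ i * f (x i)|` of a class of real functions,
for `n` independent draws from `ν` and independent uniform signs, as an extended nonnegative real. -/
def rademacher {T : Type*} [MeasurableSpace T] (n : ℕ) (ν : Measure T) (F : Set (T → ℝ)) : ℝ≥0∞ :=
  ∫⁻ x : Fin n → T,
    (∑ σ : Fin n → ℤˣ, ⨆ f ∈ F, ‖(n : ℝ)⁻¹ * ∑ i, ((σ i : ℤ) : ℝ) * f (x i)‖ₑ) / 2 ^ n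
    ∂(Measure.pi fun _ : Fin n => ν)

/-- Rademacher complexity of a class of vector-valued functions, with one independent sign for every
pair of a draw and a coordinate. -/
def rademacherVec {T : Type*} [MeasurableSpace T] {q : ℕ} (n : ℕ) (ν : Measure T)
    (G : Set (T → EuclideanSpace ℝ (Fin q))) : ℝ≥0∞ :=
  ∫⁻ x : Fin n → T,
    (∑ σ : Fin n × Fin q → ℤˣ,
      ⨆ g ∈ G, ‖(n : ℝ)⁻¹ * ∑ i, ∑ k, ((σ (i, k) : ℤ) : ℝ) * g (x i) k‖ₑ) / 2 ^ (n * q)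
    ∂(Measure.pi fun _ : Fin n => ν)

/-! ### The two data sources -/

/-- The two data sources: the trial and the observational study. -/
inductive Source
  | rct
  | os

instance : MeasurableSpace Source := ⊤

/-- Covariates measured in the trial, `(u, z)`. -/
abbrev RctCov (pu pz : ℕ) : Type := EuclideanSpace ℝ (Fin pu) × EuclideanSpace ℝ (Fin pz)

/-- Covariates measured in the observational study, `(z, v)`; the dimension is `pz + pv`. -/
abbrev OsCov (pz pv : ℕ) : Type := EuclideanSpace ℝ (Fin pz) × EuclideanSpace ℝ (Fin pv)

/-- Complete covariates, `(u, z, v)`. -/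
abbrev FullCov (pu pz pv : ℕ) : Type :=
  EuclideanSpace ℝ (Fin pu) × EuclideanSpace ℝ (Fin pz) × EuclideanSpace ℝ (Fin pv)

/-- A unit drawn at random: its source, its treatment in `{-1, 1} = ℤˣ`, its potential outcomes and its
three covariate blocks. `V` is defined for every unit although it is not recorded in the trial. -/
structure Population (pu pz pv : ℕ) (Ω : Type u) [MeasurableSpace Ω] where
  P : Measure Ω
  S : Ω → Source
  A : Ω → ℤˣ
  Ypot : ℤˣ → Ω → ℝ
  U : Ω → EuclideanSpace ℝ (Fin pu)
  Z : Ω → EuclideanSpace ℝ (Fin pz)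
  V : Ω → EuclideanSpace ℝ (Fin pv)
  isProb : IsProbabilityMeasure P
  measurable_S : Measurable S
  measurable_A : Measurable A
  measurable_U : Measurable U
  measurable_Z : Measurable Z
  measurable_V : Measurable V
  measurable_Ypot : ∀ a, Measurable (Ypot a)
  integrable_Ypot : ∀ a, Integrable (Ypot a) P
  source_pos : ∀ s, P (S ⁻¹' {s}) ≠ 0

namespace Population

variable {pu pz pv : ℕ} {Ω : Type u} [MeasurableSpace Ω] (Q : Population pu pz pv Ω)

/-- The observed outcome `Y = Y(A)`. -/
def Y (ω : Ω) : ℝ := Q.Ypot (Q.A ω) ω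

def Xr (ω : Ω) : RctCov pu pz := (Q.U ω, Q.Z ω)

def Xo (ω : Ω) : OsCov pz pv := (Q.Z ω, Q.V ω)

theorem measurable_Xr : Measurable Q.Xr := Q.measurable_U.prodMk Q.measurable_Z

/-- The law of a unit given `S = s`. -/
def given (s : Source) : Measure Ω := cond Q.P (Q.S ⁻¹' {s})

instance (s : Source) : IsFiniteMeasure (Q.given s) := by
  unfold given; infer_instance

/-- The law of a unit given `S = s` and `A = a`. -/
def givenArm (s : Source) (a : ℤˣ) : Measure Ω := cond Q.P (Q.S ⁻¹' {s} ∩ Q.A ⁻¹' {a})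

/-- `μ` is a version of `x ↦ E[Y | X = x, A = a, S = s]`. -/
def IsArmMean {T : Type*} [MeasurableSpace T] (s : Source) (a : ℤˣ) (X : Ω → T) (μ : T → ℝ) : Prop :=
  Measurable μ ∧
    (fun ω => μ (X ω)) =ᵐ[Q.givenArm s a] (Q.givenArm s a)[Q.Y | MeasurableSpace.comap X inferInstance]

/-- The trial propensity score `P(A = a | X^r, S = r)`, as a random variable. -/
def propensity (a : ℤˣ) : Ω → ℝ :=
  (Q.given .rct)[(Q.A ⁻¹' {a}).indicator (fun _ => (1 : ℝ)) |
    MeasurableSpace.comap Q.Xr inferInstance]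

/-- The target `E[Y(1) - Y(-1) | X^r, S = r]`, as a random variable. -/
def cate : Ω → ℝ :=
  (Q.given .rct)[fun ω => Q.Ypot 1 ω - Q.Ypot (-1) ω | MeasurableSpace.comap Q.Xr inferInstance]

/-- Approximation error `inf_{f ∈ F} E[(f(X^r) - τ^r(X^r))² | S = r]` of a class `F`. -/
def approxError (F : Set (RctCov pu pz → ℝ)) : ℝ≥0∞ :=
  ⨅ f ∈ F, ∫⁻ ω, ‖f (Q.Xr ω) - Q.cate ω‖ₑ ^ 2 ∂(Q.given .rct)

/-- Internal validity of the trial: given the trial covariates, treatment is independent of the pair of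
potential outcomes and both arms have probability bounded away from `0` and `1`. -/
def InternallyValid [StandardBorelSpace Ω] : Prop :=
  CondIndepFun (MeasurableSpace.comap Q.Xr inferInstance) Q.measurable_Xr.comap_le
      (fun ω => (Q.Ypot 1 ω, Q.Ypot (-1) ω)) Q.A (Q.given .rct) ∧
    ∃ ρ : ℝ, 0 < ρ ∧ ∀ a, ∀ᵐ ω ∂(Q.given .rct), ρ ≤ Q.propensity a ω ∧ Q.propensity a ω ≤ 1 - ρ

end Population

/-! ### Alignment of embeddings (Calm) -/

/-- The ingredients of Calm: encoders into `ℝ^d`, outcome classes per source and arm, discrepancy classes,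
the class of CATE corrections, the calibrated heads that were fitted, and the constants of the bound. -/
structure CalmSpec (pu pz pv d : ℕ) where
  encO : OsCov pz pv → EuclideanSpace ℝ (Fin d)
  encR : RctCov pu pz → EuclideanSpace ℝ (Fin d)
  M : Source → ℤˣ → Set (EuclideanSpace ℝ (Fin d) → ℝ)
  Dis : ℤˣ → Set (EuclideanSpace ℝ (Fin d) → ℝ)
  corr : Set (RctCov pu pz → ℝ)
  muHat : ℤˣ → EuclideanSpace ℝ (Fin d) → ℝ
  deltaHat : ℤˣ → EuclideanSpace ℝ (Fin d) → ℝ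
  eps : ℝ≥0
  Lmu : ℝ≥0
  Ldelta : ℝ≥0
  measurable_encO : Measurable encO
  measurable_encR : Measurable encR
  measurable_M : ∀ s a, ∀ f ∈ M s a, Measurable f
  measurable_Dis : ∀ a, ∀ f ∈ Dis a, Measurable f
  measurable_corr : ∀ f ∈ corr, Measurable f
  muHat_mem : ∀ a, muHat a ∈ M .os a
  deltaHat_mem : ∀ a, deltaHat a ∈ Dis a

namespace CalmSpec

variable {pu pz pv d : ℕ} {Ω : Type u} [MeasurableSpace Ω]
  (Φ : CalmSpec pu pz pv d) (Q : Population pu pz pv Ω)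

/-- The preliminary CATE `∑ a, a * (μ̂ a + δ̂ a) (φ^r x)`. -/
def prelim (x : RctCov pu pz) : ℝ :=
  ∑ a : ℤˣ, ((a : ℤ) : ℝ) * (Φ.muHat a (Φ.encR x) + Φ.deltaHat a (Φ.encR x))

/-- The class of final CATE estimators: the preliminary CATE plus a correction. -/
def cateClass : Set (RctCov pu pz → ℝ) :=
  {f | ∃ c ∈ Φ.corr, f = fun x => Φ.prelim x + c x}

/-- Alignment error `E[‖φ^o(Z, V) - φ^r(U, Z)‖² | S = r]`. -/
def alignError : ℝ≥0∞ := ∫⁻ ω, ‖Φ.encO (Q.Xo ω) - Φ.encR (Q.Xr ω)‖ₑ ^ 2 ∂(Q.given .rct)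

/-- The standing assumptions: a valid trial, embeddings that are outcome-sufficient up to the gap `eps ^ 2`
in both sources, outcome shift by a discrepancy in the class, finite alignment error, and Lipschitz
outcome and discrepancy functions. -/
structure Assumptions [StandardBorelSpace Ω] : Prop where
  valid : Q.InternallyValid
  finite_align : Φ.alignError Q < ∞
  embedding : ∃ (muT : Source → ℤˣ → EuclideanSpace ℝ (Fin d) → ℝ)
      (delta : ℤˣ → EuclideanSpace ℝ (Fin d) → ℝ),
    (∀ s a, muT s a ∈ Φ.M s a) ∧ (∀ a, delta a ∈ Φ.Dis a) ∧
    (∀ a, ∃ m, Q.IsArmMean .os a Q.Xo m ∧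
      ∫⁻ ω, ‖m (Q.Xo ω) - muT .os a (Φ.encO (Q.Xo ω))‖ₑ ^ 2 ∂(Q.given .os) ≤ (Φ.eps : ℝ≥0∞) ^ 2) ∧
    (∀ a, ∃ m, Q.IsArmMean .rct a Q.Xr m ∧
      ∫⁻ ω, ‖m (Q.Xr ω) - muT .rct a (Φ.encR (Q.Xr ω))‖ₑ ^ 2 ∂(Q.given .rct) ≤ (Φ.eps : ℝ≥0∞) ^ 2) ∧
    (∀ a h, muT .rct a h = muT .os a h + delta a h) ∧
    (∀ a, LipschitzWith Φ.Lmu (muT .os a)) ∧ (∀ a, LipschitzWith Φ.Ldelta (delta a))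

/-- Complexity of the outcome class of arm `a` on the embedded observational covariates. -/
def radOutcome (no : ℕ) (a : ℤˣ) : ℝ≥0∞ :=
  rademacher no ((Q.given .os).map fun ω => Φ.encO (Q.Xo ω)) (Φ.M .os a)

/-- Complexity of the discrepancy class of arm `a` on the embedded trial covariates. -/
def radCalib (nr : ℕ) (a : ℤˣ) : ℝ≥0∞ :=
  rademacher nr ((Q.given .rct).map fun ω => Φ.encR (Q.Xr ω)) (Φ.Dis a)

/-- Complexity of the class of final CATE estimators. -/
def radCate (nr : ℕ) : ℝ≥0∞ := rademacher nr ((Q.given .rct).map Q.Xr) Φ.cateClass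

/-- The risk bound of Calm at confidence level `1 - γ`. -/
def bound (C : ℝ≥0) (γ : ℝ) (nr no : ℕ) : ℝ≥0∞ :=
  Q.approxError Φ.cateClass + C * (ENNReal.ofReal (Real.log (1 / γ)) / nr) +
    C * ((Φ.eps : ℝ≥0∞) ^ 2 + ((Φ.Lmu : ℝ≥0∞) + Φ.Ldelta) ^ 2 * Φ.alignError Q +
      ∑ a : ℤˣ, Φ.radOutcome Q no a ^ 2 + ∑ a : ℤˣ, Φ.radCalib Q nr a ^ 2 + Φ.radCate Q nr ^ 2)

/-- The part of the bound that concerns the transfer of the observational outcome models. -/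
def transferCost (no : ℕ) : ℝ≥0∞ :=
  (Φ.eps : ℝ≥0∞) ^ 2 + ((Φ.Lmu : ℝ≥0∞) + Φ.Ldelta) ^ 2 * Φ.alignError Q +
    ∑ a : ℤˣ, Φ.radOutcome Q no a ^ 2

end CalmSpec

/-! ### Imputation (MR-Oscar) -/

/-- The ingredients of MR-Oscar: the imputation class `ℝ^pz → ℝ^pv`, outcome classes on `(z, v)`, discrepancy
and CATE-correction classes on `(u, z, v)`, the fitted imputer and calibrated heads, and a Lipschitz
constant in `v` of the outcome models. -/
structure MROscarSpec (pu pz pv : ℕ) where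
  G : Set (EuclideanSpace ℝ (Fin pz) → EuclideanSpace ℝ (Fin pv))
  M : ℤˣ → Set (OsCov pz pv → ℝ)
  Dis : ℤˣ → Set (FullCov pu pz pv → ℝ)
  corr : Set (FullCov pu pz pv → ℝ)
  gHat : EuclideanSpace ℝ (Fin pz) → EuclideanSpace ℝ (Fin pv)
  muHat : ℤˣ → OsCov pz pv → ℝ
  deltaHat : ℤˣ → FullCov pu pz pv → ℝ
  L : ℝ≥0
  measurable_G : ∀ g ∈ G, Measurable g
  measurable_M : ∀ a, ∀ f ∈ M a, Measurable f
  measurable_Dis : ∀ a, ∀ f ∈ Dis a, Measurable f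
  measurable_corr : ∀ f ∈ corr, Measurable f
  gHat_mem : gHat ∈ G
  muHat_mem : ∀ a, muHat a ∈ M a
  deltaHat_mem : ∀ a, deltaHat a ∈ Dis a
  lipschitz_M : ∀ a, ∀ f ∈ M a, ∀ z, LipschitzWith L fun v => f (z, v)

namespace MROscarSpec

variable {pu pz pv : ℕ} {Ω : Type u} [MeasurableSpace Ω]
  (W : MROscarSpec pu pz pv) (Q : Population pu pz pv Ω)

/-- Trial covariates completed by the imputed block, `(u, z, ĝ z)`. -/
def impute (x : RctCov pu pz) : FullCov pu pz pv := (x.1, x.2, W.gHat x.2)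

/-- The preliminary CATE, computed from the imputed covariates. -/
def prelim (x : RctCov pu pz) : ℝ :=
  ∑ a : ℤˣ, ((a : ℤ) : ℝ) * (W.muHat a (x.2, W.gHat x.2) + W.deltaHat a (W.impute x))

/-- The class of final CATE estimators. -/
def cateClass : Set (RctCov pu pz → ℝ) :=
  {f | ∃ c ∈ W.corr, f = fun x => W.prelim x + c (W.impute x)}

/-- Oracle imputation risk: the least value of `E[‖V - g(Z)‖² | S = o]` over the imputation class. -/
def imputeError : ℝ≥0∞ := ⨅ g ∈ W.G, ∫⁻ ω, ‖Q.V ω - g (Q.Z ω)‖ₑ ^ 2 ∂(Q.given .os)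

/-- Complexity of the outcome class of arm `a` on the observational covariates. -/
def radOutcome (no : ℕ) (a : ℤˣ) : ℝ≥0∞ := rademacher no ((Q.given .os).map Q.Xo) (W.M a)

/-- Complexity of the discrepancy class of arm `a` on the imputed trial covariates. -/
def radCalib (nr : ℕ) (a : ℤˣ) : ℝ≥0∞ :=
  rademacher nr ((Q.given .rct).map fun ω => W.impute (Q.Xr ω)) (W.Dis a)

/-- Complexity of the imputation class. -/
def radImpute (no : ℕ) : ℝ≥0∞ := rademacherVec no ((Q.given .os).map Q.Z) W.G

/-- Complexity of the class of final CATE estimators. -/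
def radCate (nr : ℕ) : ℝ≥0∞ := rademacher nr ((Q.given .rct).map Q.Xr) W.cateClass

/-- The risk bound of MR-Oscar at confidence level `1 - γ`. -/
def bound (C : ℝ≥0) (γ : ℝ) (nr no : ℕ) : ℝ≥0∞ :=
  Q.approxError W.cateClass + C * (ENNReal.ofReal (Real.log (1 / γ)) / nr) +
    C * ((W.L : ℝ≥0∞) ^ 2 * W.imputeError Q + W.radCate Q nr ^ 2 +
      ∑ a : ℤˣ, (W.radOutcome Q no a ^ 2 + W.radCalib Q nr a ^ 2) + W.radImpute Q no ^ 2)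

/-- The part of the bound that concerns imputation and the observational outcome models. -/
def transferCost (no : ℕ) : ℝ≥0∞ :=
  (W.L : ℝ≥0∞) ^ 2 * W.imputeError Q + ∑ a : ℤˣ, W.radOutcome Q no a ^ 2 + W.radImpute Q no ^ 2

end MROscarSpec

/-! ### Comparable calibration -/

/-- `x` and `y` are finite and agree up to the factor `κ`; for `κ = 1` they are equal. -/
def Comparable (κ : ℝ≥0) (x y : ℝ≥0∞) : Prop :=
  x < ∞ ∧ y < ∞ ∧ x ≤ κ * y ∧ y ≤ κ * x

/-- The calibration classes of the two methods are comparable up to the factor `κ`: the arm-specific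
discrepancy classes and the classes of final CATE estimators have finite squared complexities that agree
up to the factor `κ`, and so do the approximation errors of the latter. -/
structure ComparableCalibration {pu pz pv d : ℕ} {Ω : Type u} [MeasurableSpace Ω] (κ : ℝ≥0)
    (Q : Population pu pz pv Ω) (Φ : CalmSpec pu pz pv d) (W : MROscarSpec pu pz pv) (nr : ℕ) :
    Prop where
  calib : ∀ a, Comparable κ (Φ.radCalib Q nr a ^ 2) (W.radCalib Q nr a ^ 2)
  cate : Comparable κ (Φ.radCate Q nr ^ 2) (W.radCate Q nr ^ 2)
  approx : Comparable κ (Q.approxError Φ.cateClass) (Q.approxError W.cateClass)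

end Mismatch

end

/-!
Both risk bounds split as a calibration part, which collects the approximation error, the confidence
term and the complexities of the calibration classes, plus `C` times a transfer cost. Comparability
makes the calibration parts finite and bounds each by `κ` times the other, so comparing the bounds
amounts to comparing the transfer costs. Finiteness is what makes strict inequalities survive the
addition of the calibration parts in `[0, ∞]`.

For the sufficient regime, let `T` be the transfer cost of MR-Oscar and `θ = 1 / (4 (K² + 1))`. The
sufficiency gap and the alignment term together cost at most `θ (1 + K²) T = T / 4`. As `ψ` tends to
infinity, `4 K² ψ d ≤ ψ (pz + pv)` for large `pz + pv`, so that each outcome complexity of Calm is at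
most a quarter of that of MR-Oscar. Thus Calm costs at most `T / 2`, which is less than `T` if `T` is
finite; if `T = ∞`, it is enough that the transfer cost of Calm is finite.
-/

namespace Mismatch

variable {pu pz pv d : ℕ} {Ω : Type u} [MeasurableSpace Ω]

/-- The part of the bound of Calm that remains when `C` times the transfer cost is removed. -/
noncomputable def CalmSpec.calibrationPart (Φ : CalmSpec pu pz pv d) (Q : Population pu pz pv Ω)
    (C : ℝ≥0) (γ : ℝ) (nr : ℕ) : ℝ≥0∞ :=
  Q.approxError Φ.cateClass + C * (ENNReal.ofReal (Real.log (1 / γ)) / nr) +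
    C * (∑ a : ℤˣ, Φ.radCalib Q nr a ^ 2 + Φ.radCate Q nr ^ 2)

/-- The part of the bound of MR-Oscar that remains when `C` times the transfer cost is removed. -/
noncomputable def MROscarSpec.calibrationPart (W : MROscarSpec pu pz pv) (Q : Population pu pz pv Ω)
    (C : ℝ≥0) (γ : ℝ) (nr : ℕ) : ℝ≥0∞ :=
  Q.approxError W.cateClass + C * (ENNReal.ofReal (Real.log (1 / γ)) / nr) +
    C * (∑ a : ℤˣ, W.radCalib Q nr a ^ 2 + W.radCate Q nr ^ 2)

theorem CalmSpec.bound_eq (Φ : CalmSpec pu pz pv d) (Q : Population pu pz pv Ω) (C : ℝ≥0) (γ : ℝ)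
    (nr no : ℕ) :
    Φ.bound Q C γ nr no = Φ.calibrationPart Q C γ nr + C * Φ.transferCost Q no := by
  unfold CalmSpec.bound CalmSpec.calibrationPart CalmSpec.transferCost
  ring

theorem MROscarSpec.bound_eq (W : MROscarSpec pu pz pv) (Q : Population pu pz pv Ω) (C : ℝ≥0)
    (γ : ℝ) (nr no : ℕ) :
    W.bound Q C γ nr no = W.calibrationPart Q C γ nr + C * W.transferCost Q no := by
  unfold MROscarSpec.bound MROscarSpec.calibrationPart MROscarSpec.transferCost
  rw [Finset.sum_add_distrib]
  ring

/-- If the approximation error and the complexities in a calibration part are dominated up to the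
factor `κ ≥ 1`, so is the whole; the confidence term is common to both methods. -/
theorem calibrationPart_le {ι : Type*} {s : Finset ι} {κ C A A' l R R' : ℝ≥0∞} {D D' : ι → ℝ≥0∞}
    (hκ : 1 ≤ κ) (hA : A ≤ κ * A') (hD : ∀ i, D i ≤ κ * D' i) (hR : R ≤ κ * R') :
    A + C * l + C * (∑ i ∈ s, D i + R) ≤ κ * (A' + C * l + C * (∑ i ∈ s, D' i + R')) := by
  calc A + C * l + C * (∑ i ∈ s, D i + R)
      ≤ κ * A' + κ * (C * l) + C * (∑ i ∈ s, κ * D' i + κ * R') := by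
        have hl : C * l ≤ κ * (C * l) := le_mul_of_one_le_left' hκ
        have hsum : ∑ i ∈ s, D i ≤ ∑ i ∈ s, κ * D' i := Finset.sum_le_sum fun i _ => hD i
        gcongr
    _ = κ * (A' + C * l + C * (∑ i ∈ s, D' i + R')) := by
        rw [← Finset.mul_sum]
        ring

namespace ComparableCalibration

variable {κ : ℝ≥0} {Q : Population pu pz pv Ω} {Φ : CalmSpec pu pz pv d}
  {W : MROscarSpec pu pz pv} {nr : ℕ}

theorem calm_le (h : ComparableCalibration κ Q Φ W nr) (hκ : 1 ≤ κ) (C : ℝ≥0) (γ : ℝ) :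
    Φ.calibrationPart Q C γ nr ≤ κ * W.calibrationPart Q C γ nr :=
  calibrationPart_le (mod_cast hκ) h.approx.2.2.1 (fun a => (h.calib a).2.2.1) h.cate.2.2.1

theorem mrOscar_le (h : ComparableCalibration κ Q Φ W nr) (hκ : 1 ≤ κ) (C : ℝ≥0) (γ : ℝ) :
    W.calibrationPart Q C γ nr ≤ κ * Φ.calibrationPart Q C γ nr :=
  calibrationPart_le (mod_cast hκ) h.approx.2.2.2 (fun a => (h.calib a).2.2.2) h.cate.2.2.2

theorem calm_ne_top (h : ComparableCalibration κ Q Φ W nr) (hnr : 0 < nr) (C : ℝ≥0) (γ : ℝ) :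
    Φ.calibrationPart Q C γ nr ≠ ∞ := by
  have hl : ENNReal.ofReal (Real.log (1 / γ)) / nr ≠ ∞ :=
    ENNReal.div_ne_top ENNReal.ofReal_ne_top (by exact_mod_cast hnr.ne')
  have hD : ∑ a : ℤˣ, Φ.radCalib Q nr a ^ 2 ≠ ∞ :=
    ENNReal.sum_ne_top.2 fun a _ => (h.calib a).1.ne
  exact ENNReal.add_ne_top.2
    ⟨ENNReal.add_ne_top.2 ⟨h.approx.1.ne, ENNReal.mul_ne_top ENNReal.coe_ne_top hl⟩,
      ENNReal.mul_ne_top ENNReal.coe_ne_top (ENNReal.add_ne_top.2 ⟨hD, h.cate.1.ne⟩)⟩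

theorem bound_lt (h : ComparableCalibration κ Q Φ W nr) (hκ : 1 ≤ κ) (hnr : 0 < nr) {no : ℕ}
    {C : ℝ≥0} (hC : 0 < C) (γ : ℝ) (hlt : Φ.transferCost Q no < W.transferCost Q no) :
    Φ.bound Q C γ nr no < κ * W.bound Q C γ nr no := by
  have hκ' : (1 : ℝ≥0∞) ≤ κ := mod_cast hκ
  have hC' : (C : ℝ≥0∞) ≠ 0 := mod_cast hC.ne'
  rw [Φ.bound_eq, W.bound_eq, mul_add]
  refine ENNReal.add_lt_add_of_le_of_lt (h.calm_ne_top hnr C γ) (h.calm_le hκ C γ) ?_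
  calc (C : ℝ≥0∞) * Φ.transferCost Q no < C * W.transferCost Q no :=
        ENNReal.mul_lt_mul_right hC' ENNReal.coe_ne_top hlt
    _ ≤ κ * (C * W.transferCost Q no) := le_mul_of_one_le_left' hκ'

theorem transferCost_lt (h : ComparableCalibration κ Q Φ W nr) (hκ : 1 ≤ κ) {no : ℕ}
    {C : ℝ≥0} {γ : ℝ} (hlt : κ * Φ.bound Q C γ nr no < W.bound Q C γ nr no) :
    Φ.transferCost Q no < W.transferCost Q no := by
  have hκ' : (1 : ℝ≥0∞) ≤ κ := mod_cast hκ
  contrapose! hlt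
  rw [Φ.bound_eq, W.bound_eq, mul_add]
  refine add_le_add (h.mrOscar_le hκ C γ) ?_
  calc (C : ℝ≥0∞) * W.transferCost Q no ≤ C * Φ.transferCost Q no := by gcongr
    _ ≤ κ * (C * Φ.transferCost Q no) := le_mul_of_one_le_left' hκ'

end ComparableCalibration

/-- If the squared complexity `x` grows at most like `K t b` and `y` at least like `t c / K`, and `c`
is at least `4 K² b`, then `x` is at most a quarter of `y`. -/
theorem four_mul_le_of_governed {K t b c : ℝ≥0} {x y : ℝ≥0∞} (hx : x ≤ (K * t * b : ℝ≥0))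
    (hy : ((t * c : ℝ≥0) : ℝ≥0∞) ≤ K * y) (hbc : 4 * K ^ 2 * b ≤ c) : 4 * x ≤ y := by
  rcases eq_or_ne K 0 with rfl | hK
  · have : x = 0 := by simpa using hx
    simp [this]
  · have hK' : (K : ℝ≥0∞) ≠ 0 := mod_cast hK
    refine (ENNReal.mul_le_mul_iff_right hK' ENNReal.coe_ne_top).1 ?_
    calc (K : ℝ≥0∞) * (4 * x) ≤ K * (4 * (K * t * b : ℝ≥0)) := by gcongr
      _ = ((t * (4 * K ^ 2 * b) : ℝ≥0) : ℝ≥0∞) := by push_cast; ring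
      _ ≤ (t * c : ℝ≥0) := by gcongr
      _ ≤ K * y := hy

theorem CalmSpec.transferCost_ne_top (Φ : CalmSpec pu pz pv d) (Q : Population pu pz pv Ω) {no : ℕ}
    (hal : Φ.alignError Q < ∞) (hR : ∀ a, Φ.radOutcome Q no a ^ 2 ≠ ∞) :
    Φ.transferCost Q no ≠ ∞ :=
  ENNReal.add_ne_top.2 ⟨ENNReal.add_ne_top.2 ⟨by finiteness,
    ENNReal.mul_ne_top (by finiteness) hal.ne⟩, ENNReal.sum_ne_top.2 fun a _ => hR a⟩

/-- In the sufficient regime, Calm has at most half the transfer cost of MR-Oscar. -/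
theorem two_mul_transferCost_le {Q : Population pu pz pv Ω} {Φ : CalmSpec pu pz pv d}
    {W : MROscarSpec pu pz pv} {no : ℕ} {K θ : ℝ≥0} (hθ : 4 * (θ * (1 + K ^ 2)) ≤ 1)
    (hR : ∀ a, 4 * Φ.radOutcome Q no a ^ 2 ≤ W.radOutcome Q no a ^ 2)
    (hL : Φ.Lmu + Φ.Ldelta ≤ K * W.L) (hal : Φ.alignError Q ≤ θ * W.imputeError Q)
    (heps : (Φ.eps : ℝ≥0∞) ^ 2 ≤ θ * W.transferCost Q no) :
    2 * Φ.transferCost Q no ≤ W.transferCost Q no := by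
  have hsum : 4 * ∑ a : ℤˣ, Φ.radOutcome Q no a ^ 2 ≤ W.transferCost Q no := by
    rw [Finset.mul_sum]
    exact (Finset.sum_le_sum fun a _ => hR a).trans (le_add_left le_rfl |>.trans le_self_add)
  have himp : (W.L : ℝ≥0∞) ^ 2 * W.imputeError Q ≤ W.transferCost Q no :=
    le_self_add.trans le_self_add
  have halign : ((Φ.Lmu : ℝ≥0∞) + Φ.Ldelta) ^ 2 * Φ.alignError Q
      ≤ θ * K ^ 2 * W.transferCost Q no := by
    have hL' : (Φ.Lmu : ℝ≥0∞) + Φ.Ldelta ≤ K * W.L := mod_cast hL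
    calc ((Φ.Lmu : ℝ≥0∞) + Φ.Ldelta) ^ 2 * Φ.alignError Q
        ≤ (K * W.L) ^ 2 * (θ * W.imputeError Q) := by gcongr
      _ = θ * K ^ 2 * ((W.L : ℝ≥0∞) ^ 2 * W.imputeError Q) := by ring
      _ ≤ θ * K ^ 2 * W.transferCost Q no := by gcongr
  have hθ' : 4 * ((θ : ℝ≥0∞) * (1 + K ^ 2)) ≤ 1 := mod_cast hθ
  -- Doubling the claim keeps the quarters integral.
  refine (ENNReal.mul_le_mul_iff_right two_ne_zero ENNReal.ofNat_ne_top).1 ?_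
  calc 2 * (2 * Φ.transferCost Q no)
      = 4 * ((Φ.eps : ℝ≥0∞) ^ 2 + ((Φ.Lmu : ℝ≥0∞) + Φ.Ldelta) ^ 2 * Φ.alignError Q)
          + 4 * ∑ a : ℤˣ, Φ.radOutcome Q no a ^ 2 := by
        unfold CalmSpec.transferCost
        ring
    _ ≤ 4 * (θ * W.transferCost Q no + θ * K ^ 2 * W.transferCost Q no)
          + W.transferCost Q no := by gcongr
    _ = 4 * (θ * (1 + K ^ 2)) * W.transferCost Q no + W.transferCost Q no := by ring
    _ ≤ 1 * W.transferCost Q no + W.transferCost Q no := by gcongr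
    _ = 2 * W.transferCost Q no := by ring

end Mismatch

theorem corollary1 :
    -- Comparison of the two bounds: exactly when the transfer cost is smaller, and robustly when the
    -- calibration classes are comparable only up to a factor.
    (∀ (pu pz pv d : ℕ) (Ω : Type u) [MeasurableSpace Ω] [StandardBorelSpace Ω]
      (Q : Mismatch.Population pu pz pv Ω) (Φ : Mismatch.CalmSpec pu pz pv d)
      (W : Mismatch.MROscarSpec pu pz pv) (nr no : ℕ) (C : ℝ≥0) (γ : ℝ),
      Φ.Assumptions Q → 0 < nr → 0 < no → 0 < C → 0 < γ → γ < 1 →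
      (Mismatch.ComparableCalibration 1 Q Φ W nr →
        (Φ.bound Q C γ nr no < W.bound Q C γ nr no ↔
          (Φ.eps : ℝ≥0∞) ^ 2 + ((Φ.Lmu : ℝ≥0∞) + Φ.Ldelta) ^ 2 * Φ.alignError Q
              + ∑ a : ℤˣ, Φ.radOutcome Q no a ^ 2
            < (W.L : ℝ≥0∞) ^ 2 * W.imputeError Q + ∑ a : ℤˣ, W.radOutcome Q no a ^ 2
              + W.radImpute Q no ^ 2)) ∧
      (∀ κ : ℝ≥0, 1 ≤ κ → Mismatch.ComparableCalibration κ Q Φ W nr →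
        (Φ.transferCost Q no < W.transferCost Q no →
          Φ.bound Q C γ nr no < κ * W.bound Q C γ nr no) ∧
        (κ * Φ.bound Q C γ nr no < W.bound Q C γ nr no →
          Φ.transferCost Q no < W.transferCost Q no))) ∧
    -- Sufficient regime: the observational covariates have a much larger dimension than the embedding,
    -- the alignment error is much smaller than the imputation risk, and the sufficiency gap is small.
    (∀ K : ℝ≥0, ∃ θ : ℝ≥0, 0 < θ ∧
      ∀ ψ : ℕ → ℝ≥0, Tendsto ψ atTop atTop → ∀ d : ℕ, ∃ N : ℕ,
      ∀ (pu pz pv : ℕ) (Ω : Type u) [MeasurableSpace Ω] [StandardBorelSpace Ω]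
        (Q : Mismatch.Population pu pz pv Ω) (Φ : Mismatch.CalmSpec pu pz pv d)
        (W : Mismatch.MROscarSpec pu pz pv) (no : ℕ) (t : ℝ≥0),
        Φ.Assumptions Q → 0 < no → 0 < W.transferCost Q no →
        (∀ a, Φ.radOutcome Q no a ^ 2 ≤ (K * t * ψ d : ℝ≥0)) →
        (∀ a, ((t * ψ (pz + pv) : ℝ≥0) : ℝ≥0∞) ≤ K * W.radOutcome Q no a ^ 2) →
        Φ.Lmu + Φ.Ldelta ≤ K * W.L →
        N ≤ pz + pv →
        Φ.alignError Q ≤ θ * W.imputeError Q →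
        (Φ.eps : ℝ≥0∞) ^ 2 ≤ θ * W.transferCost Q no →
        Φ.transferCost Q no < W.transferCost Q no) := by
  refine ⟨?_, ?_⟩
  · intro pu pz pv d Ω _ _ Q Φ W nr no C γ _ hnr _ hC _ _
    refine ⟨fun h => ⟨fun hlt => ?_, fun hlt => ?_⟩, fun κ hκ h =>
      ⟨h.bound_lt hκ hnr hC γ, h.transferCost_lt hκ⟩⟩
    · exact h.transferCost_lt le_rfl (by simpa using hlt)
    · simpa using h.bound_lt le_rfl hnr hC γ hlt
  · intro K
    refine ⟨(4 * (1 + K ^ 2))⁻¹, by positivity, fun ψ hψ d => ?_⟩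
    obtain ⟨N, hN⟩ := eventually_atTop.1 (hψ.eventually_ge_atTop (4 * K ^ 2 * ψ d))
    refine ⟨N, ?_⟩
    intro pu pz pv Ω _ _ Q Φ W no t hA _ hpos hx hy hL hp hal heps
    have hfin : Φ.transferCost Q no ≠ ∞ := Φ.transferCost_ne_top Q hA.finite_align fun a =>
      ne_top_of_le_ne_top ENNReal.coe_ne_top (hx a)
    have hθ : 4 * ((4 * (1 + K ^ 2))⁻¹ * (1 + K ^ 2)) ≤ (1 : ℝ≥0) := by
      refine le_of_eq ?_
      field_simp
    have hle := Mismatch.two_mul_transferCost_le hθ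
      (fun a => Mismatch.four_mul_le_of_governed (hx a) (hy a) (hN _ hp)) hL hal heps
    rcases eq_or_ne (Φ.transferCost Q no) 0 with h0 | h0
    · rwa [h0]
    · rw [two_mul] at hle
      exact (ENNReal.lt_add_right hfin h0).trans_le hle
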